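/- Let $R\ge 1$, $T_1\ge 0$ and $L\ge 2$ be integers. A source communicates with a destination through $R$ single-antenna relays. The fading gains $f_1,\dots,f_R$ (source to relay) and $g_1,\dots,g_R$ (relay to destination) and all samples of the additive noises $n_i\in\mathbb C$, $v_i\in\mathbb C^{T_1}$ (relay $i$) and $u_1,u_2\in\mathbb C^{R}$ (destination) are independent circularly symmetric complex Gaussian variables with mean $0$ and variance $1$. The scheme consists of source vectors $s^{(1)},\dots,s^{(L)}\in\mathbb C^{T_1}$ with $\frac1L\sum_{l}\|s^{(l)}\|^2=T_1$, relay matrices $B_1,\dots,B_R\in\mathbb C^{R\times T_1}$ with $\|B_i\|_F^2\le R$, and, for each relay $i$, an operation $x\mapsto\tilde x$ that is either the identity or entrywise complex conjugation. At total power $P$, with power fractions $\pi_1=1$ and $\pi_2=1/R$, and when message $l$ is sent, relay $i$ receives the pilot $r_i^p=\sqrt{\pi_1P}\,f_i+n_i$ and the vector $r_i^s=\sqrt{\pi_1P}\,f_i s^{(l)}+v_i$. With $\beta=\sqrt{\pi_2P/(\pi_1P+1)}$ it forwards $\beta\,\tilde r_i^p$ in a slot of its own, and then all relays transmit $\beta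 B_i\tilde r_i^s$ simultaneously. The destination thus receives $Y=\begin{bmatrix}y_1\\y_2\end{bmatrix}\in\mathbb C^{2R}$ with $$(y_1)_i=g_i\beta\,\tilde r_i^p+(u_1)_i\quad(1\le i\le R),\qquad y_2=\sum_{i=1}^R g_i\,\beta B_i\tilde r_i^s+u_2 .$$ Put $C_l=\begin{bmatrix}B_1\tilde s^{(l)}&\cdots&B_R\tilde s^{(l)}\end{bmatrix}\in\mathbb C^{R\times R}$ (with the operation of relay $i$ in the $i$-th column) and $S_l=\begin{bmatrix}I_R\\C_l\end{bmatrix}$. Suppose that every $B_iB_i^H$ is diagonal, that $C_l^HC_l=C_lC_l^H=I_R$ for all $l$, and that $\operatorname{rank}(C_k-C_l)=R$ for all $k\ne l$. Then the mismatched decoder, which decides for an index $l$ maximizing $\operatorname{Tr}[Y^HS_lS_l^HY]$ (ties broken in any way), achieves full cooperative diversity $R$: its codeword error probability $P_e(P)$ for equiprobable messages satisfies $$\lim_{P\to\infty}\frac{-\log P_e(P)}{\log P}=R .$$ -/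

import Mathlib

open scoped Matrix

noncomputable section

namespace RelayNet

/-- The law of a circularly symmetric complex Gaussian variable with mean zero and unit variance:
real and imaginary parts are independent real Gaussians with mean `0` and variance `1 / 2`. -/
def stdComplexGaussian : MeasureTheory.Measure ℂ :=
  ((ProbabilityTheory.gaussianReal 0 (1 / 2)).prod (ProbabilityTheory.gaussianReal 0 (1 / 2))).map
    (fun p : ℝ × ℝ => (⟨p.1, p.2⟩ : ℂ))

/-- All random quantities of one block of the transmission protocol: fading gains and noises. -/
abbrev Realization (R T₁ T₂ : ℕ) : Type :=
  (Fin R → ℂ) × (Fin R → ℂ) × (Fin R → ℂ) × (Fin R → Fin T₁ → ℂ) × (Fin R → ℂ) × (Fin T₂ → ℂ)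

namespace Realization

variable {R T₁ T₂ : ℕ}

/-- Fading gain from the source to relay `i`. -/
def f (ω : Realization R T₁ T₂) : Fin R → ℂ := ω.1

/-- Fading gain from relay `i` to the destination. -/
def g (ω : Realization R T₁ T₂) : Fin R → ℂ := ω.2.1

/-- Noise at relay `i` in the pilot phase. -/
def n (ω : Realization R T₁ T₂) : Fin R → ℂ := ω.2.2.1

/-- Noise vector at relay `i` in the communication phase. -/
def v (ω : Realization R T₁ T₂) : Fin R → Fin T₁ → ℂ := ω.2.2.2.1

/-- Noise at the destination in the pilot phase. -/
def u₁ (ω : Realization R T₁ T₂) : Fin R → ℂ := ω.2.2.2.2.1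

/-- Noise at the destination in the communication phase. -/
def u₂ (ω : Realization R T₁ T₂) : Fin T₂ → ℂ := ω.2.2.2.2.2

end Realization

/-- All fading gains and all noise samples are independent standard complex Gaussians. -/
def law (R T₁ T₂ : ℕ) : MeasureTheory.Measure (Realization R T₁ T₂) :=
  let γ := stdComplexGaussian
  (MeasureTheory.Measure.pi fun _ => γ).prod
    ((MeasureTheory.Measure.pi fun _ => γ).prod
      ((MeasureTheory.Measure.pi fun _ => γ).prod
        ((MeasureTheory.Measure.pi fun _ => MeasureTheory.Measure.pi fun _ => γ).prod
          ((MeasureTheory.Measure.pi fun _ => γ).prod (MeasureTheory.Measure.pi fun _ => γ)))))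

/-- The data of the training-based distributed scheme with `R` relays and `L` messages. -/
structure Scheme (R T₁ T₂ L : ℕ) where
  /-- The relay matrices. -/
  B : Fin R → Matrix (Fin T₂) (Fin T₁) ℂ
  /-- Whether relay `i` processes the conjugate of what it receives (`true`) or the received
  signal itself (`false`). -/
  conjugates : Fin R → Bool
  /-- The codebook of the source. -/
  s : Fin L → Fin T₁ → ℂ
  /-- Power constraint of the source, for equiprobable messages: `E[sᴴ s] = T₁`. -/
  source_power : (∑ l, ∑ t, ‖s l t‖ ^ 2) / (L : ℝ) = T₁
  /-- Power constraint of the relays: the squared Frobenius norm is at most `T₂`. -/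
  relay_power : ∀ i, ∑ a, ∑ b, ‖B i a b‖ ^ 2 ≤ (T₂ : ℝ)

namespace Scheme

variable {R T₁ T₂ L : ℕ} (X : Scheme R T₁ T₂ L)

/-- The operation `x ↦ x̃` at relay `i`: either the identity or complex conjugation. -/
def tilde (i : Fin R) (z : ℂ) : ℂ := if X.conjugates i then (starRingEnd ℂ) z else z

/-- The codeword `C_l`, whose `i`-th column is `B_i s̃` with `s` the `l`-th source vector. -/
def C (l : Fin L) : Matrix (Fin T₂) (Fin R) ℂ :=
  Matrix.of fun a i => (X.B i *ᵥ fun t => X.tilde i (X.s l t)) a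

/-- The stacked codeword: an identity block above `C_l`. -/
def S (l : Fin L) : Matrix (Fin R ⊕ Fin T₂) (Fin R) ℂ := Matrix.fromRows 1 (X.C l)

/-- What relay `i` receives in the pilot phase, where the source sends `1` with a fraction `π₁`
of the total power `P`. -/
def relayPilot (π₁ P : ℝ) (ω : Realization R T₁ T₂) (i : Fin R) : ℂ :=
  (√(π₁ * P) : ℝ) * ω.f i + ω.n i

/-- What relay `i` receives in the communication phase when message `l` is sent. -/
def relayData (π₁ P : ℝ) (l : Fin L) (ω : Realization R T₁ T₂) (i : Fin R) : Fin T₁ → ℂ :=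
  fun t => (√(π₁ * P) : ℝ) * ω.f i * X.s l t + ω.v i t

/-- The amplification factor at the relays. -/
def relayGain (π₁ π₂ P : ℝ) : ℂ := (√(π₂ * P / (π₁ * P + 1)) : ℝ)

/-- The pilot symbol forwarded by relay `i` in its own slot. -/
def sentPilot (π₁ π₂ P : ℝ) (ω : Realization R T₁ T₂) (i : Fin R) : ℂ :=
  relayGain π₁ π₂ P * X.tilde i (relayPilot π₁ P ω i)

/-- The vector transmitted by relay `i` in the communication phase. -/
def sentData (π₁ π₂ P : ℝ) (l : Fin L) (ω : Realization R T₁ T₂) (i : Fin R) : Fin T₂ → ℂ :=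
  relayGain π₁ π₂ P • (X.B i *ᵥ fun t => X.tilde i (X.relayData π₁ P l ω i t))

/-- The received vector at the destination: `R` pilot slots, one per relay, followed by `T₂`
channel uses in which all relays transmit together. -/
def received (π₁ π₂ P : ℝ) (l : Fin L) (ω : Realization R T₁ T₂) : Fin R ⊕ Fin T₂ → ℂ :=
  Sum.elim
    (fun i => ω.g i * X.sentPilot π₁ π₂ P ω i + ω.u₁ i)
    (fun a => ∑ i, ω.g i * X.sentData π₁ π₂ P l ω i a + ω.u₂ a)

/-- The decoding metric `Tr[Yᴴ S_l S_lᴴ Y]` (a real number). -/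
def metric (l : Fin L) (y : Fin R ⊕ Fin T₂ → ℂ) : ℝ :=
  ((Matrix.replicateCol Unit y)ᴴ * X.S l * (X.S l)ᴴ * Matrix.replicateCol Unit y).trace.re

/-- `dec` is a version of the mismatched decoder: it returns a maximizer of the metric, with an
arbitrary rule for ties. -/
def IsMismatchedDecoder (dec : (Fin R ⊕ Fin T₂ → ℂ) → Fin L) : Prop :=
  ∀ y l, X.metric l y ≤ X.metric (dec y) y

/-- The codeword error probability of a decoder, for equiprobable messages, at total power `P`. -/
def errorProb (dec : (Fin R ⊕ Fin T₂ → ℂ) → Fin L) (π₁ π₂ P : ℝ) : ℝ :=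
  (∑ l, (law R T₁ T₂).real {ω | dec (X.received π₁ π₂ P l ω) ≠ l}) / (L : ℝ)

end Scheme

/-- The error probability `Pe`, as a function of the total power, has diversity order `d`:
`- log Pe(P) / log P → d` as `P → ∞`. -/
def HasDiversityOrder (Pe : ℝ → ℝ) (d : ℝ) : Prop :=
  Filter.Tendsto (fun P : ℝ => -Real.log (Pe P) / Real.log P) Filter.atTop (nhds d)

end RelayNet

end

/-!
The error probability is squeezed between two constant multiples of powers of `P`.

For unitary codewords the metric is a constant minus the squared residual `‖y₂ - C_l y₁‖²`
(`metric_eq_sub_residual`), so the decoder is a minimum-residual decoder. When message `l` is sent,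
`y₁ = h + w₁` and `y₂ = C_l h + w₂`, where the entries `h i` of the signal have modulus
`|β| √P |g i| |f i|` and the noises `w₁`, `w₂` are at most a constant times `Q`, the product of
`1 + |z|` over the gains `g` and all noise samples `z`. The residual of a competing `k` contains
`(C_l - C_k) h`, and `C_k - C_l` is invertible by the rank condition, so an error forces
`√P |g i| |f i| ≤ K Q` for every `i` simultaneously (`exists_fading_le_of_metric_le`).

*Upper bound.* For `p < 2`, the product over `i` of the `p`-th powers of `K Q / (√P |g i| |f i|)` is
at least `1` on this event. Its expectation factors over the independent Gaussians, and each factor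
is finite because `|z| ^ (-p)` is integrable near the origin of `ℂ`. Markov's inequality gives
`O(P ^ (-p R / 2))`, with `p R / 2` arbitrarily close to `R` (`exists_law_deepFade_le`).

*Lower bound.* When the rescaled gains `√P f i` are smaller than a constant and the other variables
are close to suitable values, with `h ≈ 0`, `w₁ ≈ e` and `w₂ ≈ C_k e`, the decoder errs. The first
condition has probability at least of the order `P ^ (-R)`, the second has positive probability not
depending on `P` (`eventually_le_errorProb`).
-/

open MeasureTheory ProbabilityTheory Filter Topology
open scoped ENNReal NNReal

namespace RelayNet

/-! ### Negative moments and small balls for complex Gaussians -/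

lemma lintegral_enorm_rpow_gaussianReal_lt_top {v : ℝ≥0} (hv : v ≠ 0) {r : ℝ} (hr : -1 < r) :
    ∫⁻ x, ‖x‖ₑ ^ r ∂gaussianReal 0 v < ∞ := by
  have hv' : (0 : ℝ) < v := by positivity
  have hb : (0 : ℝ) < 1 / (2 * v) := by positivity
  rw [gaussianReal_of_var_ne_zero _ hv,
    lintegral_withDensity_eq_lintegral_mul _ (measurable_gaussianPDF 0 v) (by fun_prop)]
  set F : ℝ → ℝ≥0∞ := gaussianPDF 0 v * fun x => ‖x‖ₑ ^ r with hF
  -- The integrand is even, so the half line `x > 0`, where `|x| ^ r = x ^ r`, is enough.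
  have hFneg : ∀ x, F (-x) = F x := by
    intro x
    simp [hF, gaussianPDF, gaussianPDFReal]
  have hIoi : ∫⁻ x in Set.Ioi (0 : ℝ), F x < ∞ := by
    have h := ((integrableOn_rpow_mul_exp_neg_mul_sq hb hr).const_mul
      ((√(2 * Real.pi * v))⁻¹)).lintegral_lt_top
    refine lt_of_le_of_lt (le_of_eq ?_) h
    refine setLIntegral_congr_fun measurableSet_Ioi fun x (hx : 0 < x) => ?_
    simp only [hF, Pi.mul_apply, gaussianPDF, gaussianPDFReal, sub_zero]
    rw [Real.enorm_eq_ofReal hx.le, ENNReal.ofReal_rpow_of_pos hx,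
      ← ENNReal.ofReal_mul (by positivity)]
    congr 1
    rw [show -x ^ 2 / (2 * (v : ℝ)) = -(1 / (2 * (v : ℝ))) * x ^ 2 by ring]
    ring
  have hIic : ∫⁻ x in Set.Iio (0 : ℝ), F x = ∫⁻ x in Set.Ioi (0 : ℝ), F x := by
    have h := (Measure.measurePreserving_neg (volume : Measure ℝ)).setLIntegral_comp_preimage_emb
      (Homeomorph.neg ℝ).measurableEmbedding F (Set.Ioi 0)
    simpa [hFneg] using h
  rw [← setLIntegral_univ, ← Set.Iio_union_Ici (a := (0 : ℝ))]
  refine (lintegral_union_le _ _ _).trans_lt ?_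
  rw [hIic, setLIntegral_congr Ioi_ae_eq_Ici.symm]
  exact ENNReal.add_lt_top.2 ⟨hIoi, hIoi⟩

lemma lintegral_enorm_rpow_mul_gaussianReal_lt_top {v : ℝ≥0} (hv : v ≠ 0) {p m : ℝ}
    (hp0 : 0 ≤ p) (hp : p < 1) (hm : 0 ≤ m) :
    ∫⁻ x, ‖x‖ₑ ^ (-p) * (1 + ‖x‖ₑ) ^ m ∂gaussianReal 0 v < ∞ := by
  have hle : ∀ x : ℝ, ‖x‖ₑ ^ (-p) * (1 + ‖x‖ₑ) ^ m ≤
      (2 : ℝ≥0∞) ^ m * (‖x‖ₑ ^ (-p) + ‖x‖ₑ ^ m) := by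
    intro x
    rw [mul_add]
    rcases le_total ‖x‖ₑ 1 with h | h
    · refine le_trans ?_ le_self_add
      rw [mul_comm]
      gcongr
      calc 1 + ‖x‖ₑ ≤ 1 + 1 := by gcongr
        _ = 2 := one_add_one_eq_two
    · refine le_trans ?_ le_add_self
      calc ‖x‖ₑ ^ (-p) * (1 + ‖x‖ₑ) ^ m ≤ 1 * (2 * ‖x‖ₑ) ^ m := by
            gcongr ?_ * ?_ ^ m
            · rw [ENNReal.rpow_neg, ENNReal.inv_le_one]
              simpa using ENNReal.rpow_le_rpow h hp0
            · rw [two_mul]; gcongr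
        _ = _ := by rw [one_mul, ENNReal.mul_rpow_of_nonneg _ _ hm]
  refine (lintegral_mono hle).trans_lt ?_
  rw [lintegral_const_mul _ (by fun_prop), lintegral_add_left (by fun_prop)]
  exact ENNReal.mul_lt_top (ENNReal.rpow_lt_top_of_nonneg hm (by simp)) (ENNReal.add_lt_top.2
    ⟨lintegral_enorm_rpow_gaussianReal_lt_top hv (by linarith),
      lintegral_enorm_rpow_gaussianReal_lt_top hv (by linarith)⟩)

lemma measurable_complex_mk : Measurable (fun p : ℝ × ℝ => (⟨p.1, p.2⟩ : ℂ)) :=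
  Complex.measurableEquivRealProd.symm.measurable

instance : IsProbabilityMeasure stdComplexGaussian :=
  Measure.isProbabilityMeasure_map measurable_complex_mk.aemeasurable

/-- The bounds `|x| |y| ≤ |x + iy|²` and `1 + |x + iy| ≤ (1 + |x|) (1 + |y|)` separate the
variables; the resulting real singularity `|x| ^ (-p / 2)` is integrable because `p < 2`. -/
lemma lintegral_enorm_rpow_mul_stdComplexGaussian_lt_top {p m : ℝ} (hp0 : 0 ≤ p) (hp : p < 2)
    (hm : 0 ≤ m) :
    ∫⁻ z, ‖z‖ₑ ^ (-p) * (1 + ‖z‖ₑ) ^ m ∂stdComplexGaussian < ∞ := by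
  have hle : ∀ q : ℝ × ℝ, ‖(⟨q.1, q.2⟩ : ℂ)‖ₑ ^ (-p) * (1 + ‖(⟨q.1, q.2⟩ : ℂ)‖ₑ) ^ m ≤
      (‖q.1‖ₑ ^ (-(p / 2)) * (1 + ‖q.1‖ₑ) ^ m) * (‖q.2‖ₑ ^ (-(p / 2)) * (1 + ‖q.2‖ₑ) ^ m) := by
    rintro ⟨x, y⟩
    dsimp only
    set z : ℂ := ⟨x, y⟩
    have hx : ‖x‖ₑ ≤ ‖z‖ₑ := enorm_le_iff_norm_le.2 (Complex.abs_re_le_norm z)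
    have hy : ‖y‖ₑ ≤ ‖z‖ₑ := enorm_le_iff_norm_le.2 (Complex.abs_im_le_norm z)
    have hz : ‖z‖ₑ ≤ ‖x‖ₑ + ‖y‖ₑ := by
      have := Complex.norm_le_abs_re_add_abs_im z
      rw [← ofReal_norm, ← ofReal_norm, ← ofReal_norm,
        ← ENNReal.ofReal_add (norm_nonneg _) (norm_nonneg _)]
      exact ENNReal.ofReal_le_ofReal this
    rw [mul_mul_mul_comm, ← ENNReal.mul_rpow_of_nonneg _ _ hm]
    gcongr ?_ * ?_ ^ m
    · have hfin : ‖x‖ₑ ^ (p / 2) ≠ ∞ ∧ ‖y‖ₑ ^ (p / 2) ≠ ∞ :=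
        ⟨ENNReal.rpow_ne_top_of_nonneg (by linarith) enorm_ne_top,
          ENNReal.rpow_ne_top_of_nonneg (by linarith) enorm_ne_top⟩
      rw [ENNReal.rpow_neg, ENNReal.rpow_neg, ENNReal.rpow_neg,
        ← ENNReal.mul_inv (Or.inr hfin.2) (Or.inl hfin.1), ENNReal.inv_le_inv]
      calc ‖x‖ₑ ^ (p / 2) * ‖y‖ₑ ^ (p / 2) ≤ ‖z‖ₑ ^ (p / 2) * ‖z‖ₑ ^ (p / 2) := by gcongr
        _ = ‖z‖ₑ ^ p := by
          rw [← ENNReal.rpow_add_of_nonneg _ _ (by linarith) (by linarith), add_halves]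
    · calc 1 + ‖z‖ₑ ≤ 1 + (‖x‖ₑ + ‖y‖ₑ) := by gcongr
        _ ≤ 1 + (‖x‖ₑ + ‖y‖ₑ) + ‖x‖ₑ * ‖y‖ₑ := le_self_add
        _ = _ := by ring
  have h1 : ∫⁻ x, ‖x‖ₑ ^ (-(p / 2)) * (1 + ‖x‖ₑ) ^ m ∂gaussianReal 0 (1 / 2) < ∞ :=
    lintegral_enorm_rpow_mul_gaussianReal_lt_top (by norm_num) (by linarith) (by linarith) hm
  rw [stdComplexGaussian, lintegral_map (by fun_prop) measurable_complex_mk]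
  refine (lintegral_mono hle).trans_lt ?_
  rw [lintegral_prod_mul (f := fun x : ℝ => ‖x‖ₑ ^ (-(p / 2)) * (1 + ‖x‖ₑ) ^ m)
    (g := fun x : ℝ => ‖x‖ₑ ^ (-(p / 2)) * (1 + ‖x‖ₑ) ^ m) (by fun_prop) (by fun_prop)]
  exact ENNReal.mul_lt_top h1 h1

instance : stdComplexGaussian.IsOpenPosMeasure := by
  have : (gaussianReal 0 (1 / 2)).IsOpenPosMeasure :=
    (gaussianReal_absolutelyContinuous' 0 (by norm_num)).isOpenPosMeasure
  exact Complex.equivRealProdCLM.symm.continuous.isOpenPosMeasure_map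
    Complex.equivRealProdCLM.symm.surjective

lemma exists_le_gaussianReal_Ioo :
    ∃ c : ℝ, 0 < c ∧ ∀ r : ℝ, 0 ≤ r → r ≤ 1 →
      ENNReal.ofReal (c * r) ≤ gaussianReal 0 (1 / 2) (Set.Ioo (-r) r) := by
  refine ⟨2 * gaussianPDFReal 0 (1 / 2) 1,
    by have := gaussianPDFReal_pos 0 (1 / 2) 1 (by norm_num); positivity, fun r hr0 hr => ?_⟩
  rw [gaussianReal_apply _ (by norm_num)]
  have hvol : volume (Set.Ioo (-r) r) = ENNReal.ofReal (2 * r) := by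
    rw [Real.volume_Ioo]; congr 1; ring
  calc ENNReal.ofReal (2 * gaussianPDFReal 0 (1 / 2) 1 * r)
      = gaussianPDF 0 (1 / 2) 1 * volume (Set.Ioo (-r) r) := by
        rw [hvol, gaussianPDF, ← ENNReal.ofReal_mul (gaussianPDFReal_nonneg _ _ _)]
        congr 1; ring
    _ ≤ ∫⁻ x in Set.Ioo (-r) r, gaussianPDF 0 (1 / 2) x := by
        rw [← setLIntegral_const]
        refine setLIntegral_mono (measurable_gaussianPDF _ _) fun x hx => ?_
        refine ENNReal.ofReal_le_ofReal ?_
        have hx1 : (x - 0) ^ 2 ≤ (1 - 0) ^ 2 := by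
          rw [sub_zero, sub_zero, sq_le_sq, abs_one]
          exact (abs_lt.2 hx).le.trans hr
        simp only [gaussianPDFReal]
        gcongr

/-- The mass of a small disc is at least of the order of its area. -/
lemma exists_le_stdComplexGaussian_ball :
    ∃ c : ℝ, 0 < c ∧ ∀ r : ℝ, 0 ≤ r → r ≤ 1 →
      ENNReal.ofReal (c * r ^ 2) ≤ stdComplexGaussian (Metric.ball 0 r) := by
  obtain ⟨c, hc, h⟩ := exists_le_gaussianReal_Ioo
  refine ⟨(c / 2) ^ 2, by positivity, fun r hr0 hr => ?_⟩
  rw [stdComplexGaussian, Measure.map_apply measurable_complex_mk measurableSet_ball]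
  have hsub : Set.Ioo (-(r / 2)) (r / 2) ×ˢ Set.Ioo (-(r / 2)) (r / 2) ⊆
      (fun p : ℝ × ℝ => (⟨p.1, p.2⟩ : ℂ)) ⁻¹' Metric.ball 0 r := by
    rintro ⟨x, y⟩ ⟨hx, hy⟩
    have hx' : |x| < r / 2 := abs_lt.2 hx
    have hy' : |y| < r / 2 := abs_lt.2 hy
    simp only [Set.mem_preimage, mem_ball_zero_iff]
    have := Complex.norm_le_abs_re_add_abs_im ⟨x, y⟩
    dsimp only at this
    linarith
  refine le_trans ?_ (measure_mono hsub)
  rw [Measure.prod_prod, show (c / 2) ^ 2 * r ^ 2 = (c * (r / 2)) * (c * (r / 2)) by ring,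
    ENNReal.ofReal_mul (by positivity)]
  exact mul_le_mul' (h _ (by linarith) (by linarith)) (h _ (by linarith) (by linarith))

lemma lintegral_pi_prod {ι α : Type*} [Fintype ι] [MeasurableSpace α] (μ : Measure α)
    [IsProbabilityMeasure μ] {φ : α → ℝ≥0∞} (hφ : Measurable φ) :
    ∫⁻ x, ∏ i, φ (x i) ∂(Measure.pi fun _ : ι => μ) = ∏ _i : ι, ∫⁻ z, φ z ∂μ := by
  have hind : iIndepFun (fun (i : ι) (x : ι → α) => φ (x i)) (Measure.pi fun _ : ι => μ) :=
    iIndepFun_pi (X := fun _ => φ) fun _ => hφ.aemeasurable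
  rw [lintegral_prod_eq_prod_lintegral_of_indepFun _ _ hind
    fun i => hφ.comp (measurable_pi_apply i)]
  refine Finset.prod_congr rfl fun i _ => ?_
  exact (measurePreserving_eval (fun _ : ι => μ) i).lintegral_comp hφ

/-! ### The Euclidean norm of vectors over a finite index type -/

/-- The Euclidean norm on `ι → ℂ` (whose own norm in Mathlib is the sup norm). -/
noncomputable def euclNorm {ι : Type*} [Fintype ι] (x : ι → ℂ) : ℝ := ‖WithLp.toLp 2 x‖

section euclNorm

variable {ι : Type*} [Fintype ι]

lemma euclNorm_nonneg (x : ι → ℂ) : 0 ≤ euclNorm x := norm_nonneg _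

lemma euclNorm_sub_le (x y : ι → ℂ) : euclNorm (x - y) ≤ euclNorm x + euclNorm y := by
  simpa [euclNorm] using norm_sub_le (WithLp.toLp 2 x) (WithLp.toLp 2 y)

lemma euclNorm_eq_zero {x : ι → ℂ} : euclNorm x = 0 ↔ x = 0 := by
  simp [euclNorm]

lemma euclNorm_parallelogram (x y : ι → ℂ) :
    euclNorm (x + y) ^ 2 = 2 * (euclNorm x ^ 2 + euclNorm y ^ 2) - euclNorm (y - x) ^ 2 := by
  have h := parallelogram_law_with_norm ℂ (WithLp.toLp 2 x) (WithLp.toLp 2 y)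
  rw [norm_sub_rev] at h
  simp only [euclNorm, WithLp.toLp_add, WithLp.toLp_sub]
  linarith

lemma norm_apply_le_euclNorm (x : ι → ℂ) (i : ι) : ‖x i‖ ≤ euclNorm x :=
  PiLp.norm_apply_le (WithLp.toLp 2 x) i

lemma euclNorm_le_of_forall_norm_le {x : ι → ℂ} {M : ℝ} (hM : 0 ≤ M) (h : ∀ i, ‖x i‖ ≤ M) :
    euclNorm x ≤ Fintype.card ι * M := by
  rw [euclNorm, EuclideanSpace.norm_eq]
  refine Real.sqrt_le_iff.2 ⟨by positivity, ?_⟩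
  have hcard : (Fintype.card ι : ℝ) ≤ (Fintype.card ι : ℝ) ^ 2 := by
    exact_mod_cast Nat.le_self_pow two_ne_zero _
  calc ∑ i, ‖x i‖ ^ 2 ≤ ∑ _i : ι, M ^ 2 := by gcongr with i; exact h i
    _ = Fintype.card ι * M ^ 2 := by simp
    _ ≤ Fintype.card ι ^ 2 * M ^ 2 := by gcongr
    _ = _ := by ring

lemma ofReal_euclNorm_sq (x : ι → ℂ) : ((euclNorm x ^ 2 : ℝ) : ℂ) = star x ⬝ᵥ x := by
  have h := inner_self_eq_norm_sq_to_K (𝕜 := ℂ) (WithLp.toLp 2 x)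
  rw [EuclideanSpace.inner_eq_star_dotProduct, dotProduct_comm] at h
  rw [h]
  simp [euclNorm]

lemma euclNorm_mulVec [DecidableEq ι] {U : Matrix ι ι ℂ} (hU : Uᴴ * U = 1) (x : ι → ℂ) :
    euclNorm (U *ᵥ x) = euclNorm x := by
  have h : ((euclNorm (U *ᵥ x) ^ 2 : ℝ) : ℂ) = ((euclNorm x ^ 2 : ℝ) : ℂ) := by
    rw [ofReal_euclNorm_sq, ofReal_euclNorm_sq, Matrix.star_mulVec, ← Matrix.dotProduct_mulVec,
      Matrix.mulVec_mulVec, hU, Matrix.one_mulVec]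
  exact (sq_eq_sq₀ (euclNorm_nonneg _) (euclNorm_nonneg _)).1 (by exact_mod_cast h)

lemma isUnit_det_of_rank_eq_card [DecidableEq ι] {D : Matrix ι ι ℂ}
    (hD : D.rank = Fintype.card ι) : IsUnit D.det := by
  rw [← Matrix.isUnit_iff_isUnit_det, ← Matrix.mulVec_surjective_iff_isUnit]
  have : LinearMap.range D.mulVecLin = ⊤ := by
    apply Submodule.eq_top_of_finrank_eq
    rw [Module.finrank_fintype_fun_eq_card]
    exact hD
  exact LinearMap.range_eq_top.1 this

lemma exists_norm_apply_le_euclNorm_mulVec [DecidableEq ι] {D : Matrix ι ι ℂ}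
    (hD : D.rank = Fintype.card ι) :
    ∃ K : ℝ, 0 ≤ K ∧ ∀ (x : ι → ℂ) (i : ι), ‖x i‖ ≤ K * euclNorm (D *ᵥ x) := by
  refine ⟨∑ i, ∑ j, ‖D⁻¹ i j‖, by positivity, fun x i => ?_⟩
  have hx : x = D⁻¹ *ᵥ (D *ᵥ x) := by
    rw [Matrix.mulVec_mulVec, Matrix.nonsing_inv_mul _ (isUnit_det_of_rank_eq_card hD),
      Matrix.one_mulVec]
  calc ‖x i‖ = ‖∑ j, D⁻¹ i j * (D *ᵥ x) j‖ := by
        conv_lhs => rw [hx]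
        rfl
    _ ≤ ∑ j, ‖D⁻¹ i j‖ * euclNorm (D *ᵥ x) := by
        refine (norm_sum_le _ _).trans (Finset.sum_le_sum fun j _ => ?_)
        rw [norm_mul]
        gcongr
        exact norm_apply_le_euclNorm _ _
    _ = (∑ j, ‖D⁻¹ i j‖) * euclNorm (D *ᵥ x) := by rw [Finset.sum_mul]
    _ ≤ _ := mul_le_mul_of_nonneg_right (Finset.single_le_sum (f := fun i => ∑ j, ‖D⁻¹ i j‖)
        (fun i _ => by positivity) (Finset.mem_univ i)) (euclNorm_nonneg _)

end euclNorm

/-! ### The decoding metric and the received vector -/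

namespace Scheme

variable {R T₁ L : ℕ} (X : Scheme R T₁ R L)

lemma metric_eq_euclNorm_sq (l : Fin L) (y : Fin R ⊕ Fin R → ℂ) :
    X.metric l y = euclNorm (y ∘ Sum.inl + (X.C l)ᴴ *ᵥ (y ∘ Sum.inr)) ^ 2 := by
  have hv : (X.S l)ᴴ *ᵥ y = y ∘ Sum.inl + (X.C l)ᴴ *ᵥ (y ∘ Sum.inr) := by
    rw [S, Matrix.conjTranspose_fromRows_eq_fromCols_conjTranspose, ← Sum.elim_comp_inl_inr y,
      Matrix.fromCols_mulVec_sumElim]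
    simp
  rw [← hv, ← Complex.ofReal_re (euclNorm _ ^ 2), ofReal_euclNorm_sq, metric]
  congr 1
  rw [Matrix.mul_assoc, Matrix.mul_assoc, ← Matrix.mul_assoc, ← Matrix.replicateCol_mulVec,
    show (Matrix.replicateCol Unit y)ᴴ * X.S l = (Matrix.replicateCol Unit ((X.S l)ᴴ *ᵥ y))ᴴ by
      rw [Matrix.replicateCol_mulVec, Matrix.conjTranspose_mul,
        Matrix.conjTranspose_conjTranspose]]
  simp [Matrix.trace, Matrix.mul_apply, dotProduct]

/-- For a unitary codeword, maximizing the metric means minimizing the residual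
`‖y₂ - C_l y₁‖`. -/
lemma metric_eq_sub_residual {l : Fin L} (hC : (X.C l)ᴴ * X.C l = 1 ∧ X.C l * (X.C l)ᴴ = 1)
    (y : Fin R ⊕ Fin R → ℂ) :
    X.metric l y = 2 * (euclNorm (y ∘ Sum.inl) ^ 2 + euclNorm (y ∘ Sum.inr) ^ 2) -
      euclNorm (y ∘ Sum.inr - X.C l *ᵥ (y ∘ Sum.inl)) ^ 2 := by
  rw [metric_eq_euclNorm_sq, ← euclNorm_mulVec hC.1, Matrix.mulVec_add, Matrix.mulVec_mulVec, hC.2,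
    Matrix.one_mulVec, euclNorm_parallelogram, euclNorm_mulVec hC.1]

lemma residual_le_of_metric_le {k l : Fin L}
    (hC : ∀ l, (X.C l)ᴴ * X.C l = 1 ∧ X.C l * (X.C l)ᴴ = 1) {y : Fin R ⊕ Fin R → ℂ}
    (h : X.metric l y ≤ X.metric k y) :
    euclNorm (y ∘ Sum.inr - X.C k *ᵥ (y ∘ Sum.inl)) ≤
      euclNorm (y ∘ Sum.inr - X.C l *ᵥ (y ∘ Sum.inl)) := by
  rw [X.metric_eq_sub_residual (hC l), X.metric_eq_sub_residual (hC k)] at h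
  exact (sq_le_sq₀ (euclNorm_nonneg _) (euclNorm_nonneg _)).1 (by linarith)

lemma continuous_metric (l : Fin L) : Continuous (X.metric l) := by
  unfold metric
  fun_prop

lemma tilde_add (i : Fin R) (z w : ℂ) : X.tilde i (z + w) = X.tilde i z + X.tilde i w := by
  unfold tilde; split_ifs <;> simp

lemma tilde_mul (i : Fin R) (z w : ℂ) : X.tilde i (z * w) = X.tilde i z * X.tilde i w := by
  unfold tilde; split_ifs <;> simp

lemma norm_tilde (i : Fin R) (z : ℂ) : ‖X.tilde i z‖ = ‖z‖ := by
  unfold tilde; split_ifs <;> simp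

lemma continuous_tilde (i : Fin R) : Continuous (X.tilde i) := by
  unfold tilde; split_ifs <;> fun_prop

/-- The signal part of the received pilots, for the relay amplification `b`. -/
noncomputable def signal (b : ℂ) (ω : Realization R T₁ R) (i : Fin R) : ℂ :=
  ω.g i * (b * X.tilde i (ω.f i))

/-- The noise in the pilot slots: destination noise and amplified relay noise. -/
noncomputable def pilotNoise (b : ℂ) (ω : Realization R T₁ R) (i : Fin R) : ℂ :=
  ω.g i * (b * X.tilde i (ω.n i)) + ω.u₁ i

/-- The noise in the communication phase: destination noise and amplified relay noise. -/
noncomputable def dataNoise (b : ℂ) (ω : Realization R T₁ R) (a : Fin R) : ℂ :=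
  ∑ i, ω.g i * (b * (X.B i *ᵥ fun t => X.tilde i (ω.v i t)) a) + ω.u₂ a

/-- The vector at the destination when the relays amplify by `b` and the fading gains `f` already
include the amplitude of the source. -/
noncomputable def output (b : ℂ) (l : Fin L) (ω : Realization R T₁ R) : Fin R ⊕ Fin R → ℂ :=
  Sum.elim (X.signal b ω + X.pilotNoise b ω) (X.C l *ᵥ X.signal b ω + X.dataNoise b ω)

/-- The realization with the source-to-relay gains multiplied by `a`. -/
noncomputable def scaleFading (a : ℝ) (ω : Realization R T₁ R) : Realization R T₁ R :=
  (fun i => (a : ℂ) * ω.f i, ω.2)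

lemma received_eq_output (π₁ π₂ P : ℝ) (l : Fin L) (ω : Realization R T₁ R) :
    X.received π₁ π₂ P l ω =
      X.output (relayGain π₁ π₂ P) l (scaleFading √(π₁ * P) ω) := by
  funext j
  rcases j with i | a
  · simp only [received, output, signal, pilotNoise, sentPilot, relayPilot, Sum.elim_inl,
      Pi.add_apply, tilde_add, scaleFading, Realization.f, Realization.g, Realization.n,
      Realization.u₁]
    ring
  · simp only [received, output, signal, dataNoise, sentData, relayData, Sum.elim_inr,
      Pi.add_apply, Pi.smul_apply, smul_eq_mul, tilde_add, scaleFading, Realization.f,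
      Realization.g, Realization.v, Realization.u₂, C, Matrix.mulVec, dotProduct, Matrix.of_apply,
      tilde_mul, mul_add, Finset.sum_add_distrib, Finset.mul_sum, Finset.sum_mul]
    rw [← add_assoc]
    congr 2
    refine Finset.sum_congr rfl fun i _ => Finset.sum_congr rfl fun t _ => ?_
    ring

lemma continuous_output (l : Fin L) :
    Continuous fun q : ℂ × Realization R T₁ R => X.output q.1 l q.2 := by
  have ht := X.continuous_tilde
  have hsignal : Continuous fun q : ℂ × Realization R T₁ R => X.signal q.1 q.2 := by
    refine continuous_pi fun i => ?_
    have := ht i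
    simp only [signal, Realization.f, Realization.g]
    fun_prop
  have hpilot : Continuous fun q : ℂ × Realization R T₁ R => X.pilotNoise q.1 q.2 := by
    refine continuous_pi fun i => ?_
    have := ht i
    simp only [pilotNoise, Realization.n, Realization.g, Realization.u₁]
    fun_prop
  have hdata : Continuous fun q : ℂ × Realization R T₁ R => X.dataNoise q.1 q.2 := by
    refine continuous_pi fun a => ?_
    simp only [dataNoise, Realization.v, Realization.g, Realization.u₂, Matrix.mulVec, dotProduct]
    fun_prop
  refine continuous_pi fun j => ?_
  rcases j with i | a
  · exact (continuous_apply i).comp (hsignal.add hpilot)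
  · exact (continuous_apply a).comp ((continuous_const.matrix_mulVec hsignal).add hdata)

/-- Residuals of the true and of a competing codeword differ by `(C_l - C_k) h`, up to noise. -/
lemma euclNorm_mulVec_signal_le {k l : Fin L}
    (hC : ∀ l, (X.C l)ᴴ * X.C l = 1 ∧ X.C l * (X.C l)ᴴ = 1) {b : ℂ} {ω : Realization R T₁ R}
    (h : X.metric l (X.output b l ω) ≤ X.metric k (X.output b l ω)) :
    euclNorm ((X.C k - X.C l) *ᵥ X.signal b ω) ≤
      2 * (euclNorm (X.pilotNoise b ω) + euclNorm (X.dataNoise b ω)) := by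
  have h1 := X.residual_le_of_metric_le hC h
  simp only [output, Sum.elim_comp_inl, Sum.elim_comp_inr] at h1
  set s := X.signal b ω
  set w₁ := X.pilotNoise b ω
  set w₂ := X.dataNoise b ω
  have e1 : X.C l *ᵥ s + w₂ - X.C l *ᵥ (s + w₁) = w₂ - X.C l *ᵥ w₁ := by
    rw [Matrix.mulVec_add]; abel
  have e2 : (X.C k - X.C l) *ᵥ s =
      (w₂ - X.C k *ᵥ w₁) - (X.C l *ᵥ s + w₂ - X.C k *ᵥ (s + w₁)) := by
    rw [Matrix.mulVec_add, Matrix.sub_mulVec]; abel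
  rw [e1] at h1
  have h2 := euclNorm_sub_le w₂ (X.C l *ᵥ w₁)
  have h3 := euclNorm_sub_le w₂ (X.C k *ᵥ w₁)
  have h4 := euclNorm_sub_le (w₂ - X.C k *ᵥ w₁) (X.C l *ᵥ s + w₂ - X.C k *ᵥ (s + w₁))
  rw [euclNorm_mulVec (hC _).1] at h2 h3
  rw [e2]
  linarith

end Scheme

/-! ### Diversity order from two-sided power bounds -/

lemma hasDiversityOrder_of_bounds {Pe : ℝ → ℝ} {d : ℝ} (hd : 0 < d)
    (hupper : ∀ t, 0 < t → t < d → ∃ K : ℝ, ∀ᶠ P in atTop, Pe P ≤ K * P ^ (-t))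
    (hlower : ∃ c : ℝ, 0 < c ∧ ∀ᶠ P in atTop, c * P ^ (-d) ≤ Pe P) : HasDiversityOrder Pe d := by
  obtain ⟨c, hc, hlower⟩ := hlower
  have hlim : ∀ t x : ℝ, Tendsto (fun P : ℝ => t - x / Real.log P) atTop (𝓝 t) := fun t x => by
    simpa using tendsto_const_nhds.sub (Real.tendsto_log_atTop.const_div_atTop x)
  refine tendsto_order.2 ⟨fun a ha => ?_, fun a ha => ?_⟩
  · obtain ⟨t, ht, htd⟩ := exists_between (max_lt ha hd)
    obtain ⟨hat, ht0⟩ := max_lt_iff.1 ht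
    obtain ⟨K, hK⟩ := hupper t ht0 htd
    filter_upwards [hK, hlower, (hlim t (Real.log K)).eventually_const_lt hat,
      eventually_gt_atTop 1] with P h1 h2 h3 h4
    have hP : 0 < P := by linarith
    have hlog : 0 < Real.log P := Real.log_pos h4
    have hPe : 0 < Pe P := lt_of_lt_of_le (by positivity) h2
    have hKpos : 0 < K := pos_of_mul_pos_left (hPe.trans_le h1) (by positivity)
    refine h3.trans_le ?_
    have := Real.log_le_log hPe h1
    rw [Real.log_mul hKpos.ne' (by positivity), Real.log_rpow hP] at this
    rw [le_div_iff₀ hlog, sub_mul, div_mul_cancel₀ _ hlog.ne']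
    linarith
  · filter_upwards [hlower, (hlim d (Real.log c)).eventually_lt_const ha,
      eventually_gt_atTop 1] with P h2 h3 h4
    have hP : 0 < P := by linarith
    have hlog : 0 < Real.log P := Real.log_pos h4
    refine lt_of_le_of_lt ?_ h3
    have := Real.log_le_log (by positivity) h2
    rw [Real.log_mul hc.ne' (by positivity), Real.log_rpow hP] at this
    rw [div_le_iff₀ hlog, sub_mul, div_mul_cancel₀ _ hlog.ne']
    linarith

/-! ### The noise envelope and the error event -/

/-- The product of all `1 + |x i|`. It dominates every coordinate of `x`, and, being a product, its
moments factor when the coordinates are independent. -/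
noncomputable def envelope {ι : Type*} [Fintype ι] (x : ι → ℂ) : ℝ := ∏ i, (1 + ‖x i‖)

lemma le_prod_of_one_le {ι : Type*} [Fintype ι] {f : ι → ℝ} (hf : ∀ i, 1 ≤ f i) (i : ι) :
    f i ≤ ∏ j, f j := by
  simpa using Finset.prod_le_prod_of_subset_of_one_le (Finset.subset_univ {i})
    (fun j _ => zero_le_one.trans (hf j)) (fun j _ _ => hf j)

section envelope

variable {ι : Type*} [Fintype ι]

lemma one_le_envelope (x : ι → ℂ) : 1 ≤ envelope x :=
  Finset.one_le_prod fun i _ => by simp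

lemma norm_apply_le_envelope (x : ι → ℂ) (i : ι) : ‖x i‖ ≤ envelope x :=
  (show ‖x i‖ ≤ 1 + ‖x i‖ by simp).trans
    (le_prod_of_one_le (f := fun i => 1 + ‖x i‖) (fun j => by simp) i)

lemma ofReal_envelope (x : ι → ℂ) : ENNReal.ofReal (envelope x) = ∏ i, (1 + ‖x i‖ₑ) := by
  rw [envelope, ENNReal.ofReal_prod_of_nonneg fun i _ => by positivity]
  refine Finset.prod_congr rfl fun i _ => ?_
  rw [ENNReal.ofReal_add zero_le_one (norm_nonneg _), ENNReal.ofReal_one, ofReal_norm]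

end envelope

/-- The product of `1 + |z|` over the relay-to-destination gains and all noise samples `z`. -/
noncomputable def Realization.noiseEnvelope {R T₁ T₂ : ℕ} (ω : Realization R T₁ T₂) : ℝ :=
  envelope ω.g * (envelope ω.n * ((∏ i, envelope (ω.v i)) * (envelope ω.u₁ * envelope ω.u₂)))

lemma Realization.le_noiseEnvelope {R T₁ T₂ : ℕ} (ω : Realization R T₁ T₂) :
    envelope ω.g * envelope ω.n ≤ ω.noiseEnvelope ∧
    envelope ω.g * ∏ i, envelope (ω.v i) ≤ ω.noiseEnvelope ∧
    envelope ω.u₁ ≤ ω.noiseEnvelope ∧ envelope ω.u₂ ≤ ω.noiseEnvelope := by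
  have hv : 1 ≤ ∏ i, envelope (ω.v i) := Finset.one_le_prod fun i _ => one_le_envelope _
  have key : ∀ {a b c d e : ℝ}, 1 ≤ a → 1 ≤ b → 1 ≤ c → 1 ≤ d → 1 ≤ e →
      a * b ≤ a * (b * (c * (d * e))) ∧ a * c ≤ a * (b * (c * (d * e))) ∧
      d ≤ a * (b * (c * (d * e))) ∧ e ≤ a * (b * (c * (d * e))) := by
    intro a b c d e ha hb hc hd he
    have hde := one_le_mul_of_one_le_of_one_le hd he
    have hcde := one_le_mul_of_one_le_of_one_le hc hde
    have h1 : c ≤ c * (d * e) := le_mul_of_one_le_right (by linarith) hde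
    have h2 : c * (d * e) ≤ b * (c * (d * e)) := le_mul_of_one_le_left (by linarith) hb
    have h3 : b * (c * (d * e)) ≤ a * (b * (c * (d * e))) :=
      le_mul_of_one_le_left (by linarith) ha
    have h4 : d * e ≤ c * (d * e) := le_mul_of_one_le_left (by linarith) hc
    have h5 : d ≤ d * e := le_mul_of_one_le_right (by linarith) he
    have h6 : e ≤ d * e := le_mul_of_one_le_left (by linarith) hd
    exact ⟨mul_le_mul_of_nonneg_left (le_mul_of_one_le_right (by linarith) hcde) (by linarith),
      mul_le_mul_of_nonneg_left (h1.trans h2) (by linarith), by linarith, by linarith⟩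
  exact key (one_le_envelope _) (one_le_envelope _) hv (one_le_envelope _) (one_le_envelope _)

lemma Realization.noiseEnvelope_nonneg {R T₁ T₂ : ℕ} (ω : Realization R T₁ T₂) :
    0 ≤ ω.noiseEnvelope :=
  (zero_le_one.trans (one_le_envelope _)).trans ω.le_noiseEnvelope.2.2.1

namespace Scheme

variable {R T₁ L : ℕ} (X : Scheme R T₁ R L)

lemma norm_pilotNoise_le {b : ℂ} (hb : ‖b‖ ≤ 2) (ω : Realization R T₁ R) (i : Fin R) :
    ‖X.pilotNoise b ω i‖ ≤ 3 * ω.noiseEnvelope := by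
  have h1 : ‖ω.g i * (b * X.tilde i (ω.n i))‖ ≤ 2 * (envelope ω.g * envelope ω.n) := by
    rw [norm_mul, norm_mul, norm_tilde]
    calc ‖ω.g i‖ * (‖b‖ * ‖ω.n i‖) ≤ envelope ω.g * (2 * envelope ω.n) := by
          have := one_le_envelope ω.g
          gcongr
          · exact norm_apply_le_envelope _ _
          · exact norm_apply_le_envelope _ _
      _ = _ := by ring
  have h2 := norm_apply_le_envelope ω.u₁ i
  obtain ⟨h3, -, h4, -⟩ := ω.le_noiseEnvelope
  have := norm_add_le (ω.g i * (b * X.tilde i (ω.n i))) (ω.u₁ i)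
  rw [pilotNoise]
  linarith

lemma exists_norm_dataNoise_le :
    ∃ K : ℝ, 0 ≤ K ∧ ∀ {b : ℂ}, ‖b‖ ≤ 2 → ∀ (ω : Realization R T₁ R) (a : Fin R),
      ‖X.dataNoise b ω a‖ ≤ K * ω.noiseEnvelope := by
  set M : Fin R → ℝ := fun a => ∑ i, ∑ t, ‖X.B i a t‖ with hM
  have hM0 : ∀ a, 0 ≤ M a := fun a => by positivity
  refine ⟨2 * (∑ a, M a) + 1, by positivity, fun {b} hb ω a => ?_⟩
  obtain ⟨-, h3, -, h4⟩ := ω.le_noiseEnvelope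
  have hv : ∀ i t, ‖ω.v i t‖ ≤ ∏ i, envelope (ω.v i) := fun i t =>
    (norm_apply_le_envelope (ω.v i) t).trans
      (le_prod_of_one_le (f := fun i => envelope (ω.v i)) (fun j => one_le_envelope _) i)
  have hterm : ∀ i, ‖ω.g i * (b * (X.B i *ᵥ fun t => X.tilde i (ω.v i t)) a)‖ ≤
      2 * (∑ t, ‖X.B i a t‖) * (envelope ω.g * ∏ i, envelope (ω.v i)) := fun i => by
    have hmul : ‖(X.B i *ᵥ fun t => X.tilde i (ω.v i t)) a‖ ≤
        (∑ t, ‖X.B i a t‖) * ∏ i, envelope (ω.v i) := by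
      rw [Finset.sum_mul]
      refine (norm_sum_le Finset.univ fun t => X.B i a t * X.tilde i (ω.v i t)).trans
        (Finset.sum_le_sum fun t _ => ?_)
      rw [norm_mul, norm_tilde]
      exact mul_le_mul_of_nonneg_left (hv i t) (norm_nonneg _)
    rw [norm_mul, norm_mul]
    calc _ ≤ envelope ω.g * (2 * ((∑ t, ‖X.B i a t‖) * ∏ i, envelope (ω.v i))) := by
          have := one_le_envelope ω.g
          gcongr
          exact norm_apply_le_envelope _ _
      _ = _ := by ring
  have hsum : ‖∑ i, ω.g i * (b * (X.B i *ᵥ fun t => X.tilde i (ω.v i t)) a)‖ ≤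
      2 * M a * (envelope ω.g * ∏ i, envelope (ω.v i)) := by
    refine (norm_sum_le _ _).trans ((Finset.sum_le_sum fun i _ => hterm i).trans_eq ?_)
    rw [← Finset.sum_mul, ← Finset.mul_sum]
  have hMa : M a ≤ ∑ a, M a := Finset.single_le_sum (fun a _ => hM0 a) (Finset.mem_univ a)
  calc ‖X.dataNoise b ω a‖
      ≤ 2 * M a * (envelope ω.g * ∏ i, envelope (ω.v i)) + envelope ω.u₂ :=
        (norm_add_le _ _).trans (add_le_add hsum (norm_apply_le_envelope _ _))
    _ ≤ 2 * M a * ω.noiseEnvelope + ω.noiseEnvelope := by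
        gcongr
    _ ≤ 2 * (∑ a, M a) * ω.noiseEnvelope + ω.noiseEnvelope := by
        gcongr
        exact ω.noiseEnvelope_nonneg
    _ = _ := by ring

/-- An error with a competitor `k` forces every product channel to be weak compared with the noise.
The gain bounds `b₀ ≤ ‖b‖ ≤ 2` hold for all large powers, so `K` does not depend on the power. -/
lemma exists_fading_le_of_metric_le (hC : ∀ l, (X.C l)ᴴ * X.C l = 1 ∧ X.C l * (X.C l)ᴴ = 1)
    {k l : Fin L} (hrank : (X.C k - X.C l).rank = R) {b₀ : ℝ} (hb₀ : 0 < b₀) :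
    ∃ K : ℝ, ∀ (a : ℝ) (b : ℂ) (ω : Realization R T₁ R), 0 ≤ a → b₀ ≤ ‖b‖ → ‖b‖ ≤ 2 →
      X.metric l (X.output b l (scaleFading a ω)) ≤ X.metric k (X.output b l (scaleFading a ω)) →
      ∀ i, a * (‖ω.g i‖ * ‖ω.f i‖) ≤ K * ω.noiseEnvelope := by
  obtain ⟨D, hD0, hD⟩ := exists_norm_apply_le_euclNorm_mulVec
    (hrank.trans (Fintype.card_fin R).symm)
  obtain ⟨N, hN0, hN⟩ := X.exists_norm_dataNoise_le
  refine ⟨D * (2 * (R * 3 + R * N)) / b₀, fun a b ω ha hb hb2 h i => ?_⟩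
  have hQ := ω.noiseEnvelope_nonneg
  have h1 := hD (X.signal b (scaleFading a ω)) i
  have h2 := X.euclNorm_mulVec_signal_le hC h
  have h3 : euclNorm (X.pilotNoise b (scaleFading a ω)) ≤ R * (3 * ω.noiseEnvelope) := by
    have := euclNorm_le_of_forall_norm_le (by positivity)
      (fun i => X.norm_pilotNoise_le hb2 (scaleFading a ω) i)
    rwa [Fintype.card_fin] at this
  have h4 : euclNorm (X.dataNoise b (scaleFading a ω)) ≤ R * (N * ω.noiseEnvelope) := by
    have := euclNorm_le_of_forall_norm_le (by positivity)
      (fun i => hN hb2 (scaleFading a ω) i)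
    rwa [Fintype.card_fin] at this
  have h5 : ‖X.signal b (scaleFading a ω) i‖ = ‖b‖ * (a * (‖ω.g i‖ * ‖ω.f i‖)) := by
    simp only [signal, scaleFading, Realization.f, Realization.g, norm_mul, norm_tilde,
      Complex.norm_real, Real.norm_of_nonneg ha]
    ring
  rw [div_mul_eq_mul_div, le_div_iff₀ hb₀]
  calc a * (‖ω.g i‖ * ‖ω.f i‖) * b₀ ≤ a * (‖ω.g i‖ * ‖ω.f i‖) * ‖b‖ := by gcongr
    _ ≤ D * (2 * (R * (3 * ω.noiseEnvelope) + R * (N * ω.noiseEnvelope))) := by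
        rw [mul_comm, ← h5]
        refine h1.trans (mul_le_mul_of_nonneg_left (h2.trans ?_) hD0)
        linarith
    _ = _ := by ring

end Scheme

/-! ### Probability that all product channels are in a deep fade -/

instance (R T₁ T₂ : ℕ) : IsProbabilityMeasure (law R T₁ T₂) := by
  unfold law; infer_instance

lemma one_le_rpow_mul_of_mul_le {a b K : ℝ≥0∞} (ha : a ≠ ∞) (hb : b ≠ ∞) (hK0 : K ≠ 0)
    (hK : K ≠ ∞) {p : ℝ} (hp : 0 ≤ p) (h : a * b ≤ K) :
    1 ≤ K ^ p * (a ^ (-p) * b ^ (-p)) := by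
  have ha' := ENNReal.rpow_ne_top_of_nonneg hp ha
  have hb' := ENNReal.rpow_ne_top_of_nonneg hp hb
  rw [ENNReal.rpow_neg, ENNReal.rpow_neg, ← ENNReal.mul_inv (Or.inr hb') (Or.inl ha'),
    ← ENNReal.mul_rpow_of_nonneg _ _ hp]
  calc (1 : ℝ≥0∞) = K ^ p * (K ^ p)⁻¹ := (ENNReal.mul_inv_cancel
        (by simp [ENNReal.rpow_eq_zero_iff, hK0, hK]) (ENNReal.rpow_ne_top_of_nonneg hp hK)).symm
    _ ≤ _ := by gcongr

lemma measurable_and_lintegral_pi_lt_top {ι α : Type*} [Fintype ι] [MeasurableSpace α]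
    {μ : Measure α} [IsProbabilityMeasure μ] {φ : α → ℝ≥0∞}
    (hφ : Measurable φ ∧ ∫⁻ z, φ z ∂μ < ∞) :
    Measurable (fun x : ι → α => ∏ i, φ (x i)) ∧
      ∫⁻ x, ∏ i, φ (x i) ∂(Measure.pi fun _ : ι => μ) < ∞ := by
  have hm := hφ.1
  refine ⟨by fun_prop, ?_⟩
  rw [lintegral_pi_prod _ hφ.1]
  exact ENNReal.prod_lt_top fun _ _ => hφ.2

lemma measurable_and_lintegral_prod_lt_top {α β : Type*} [MeasurableSpace α] [MeasurableSpace β]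
    {μ : Measure α} {ν : Measure β} [SFinite ν] {φ : α → ℝ≥0∞} {ψ : β → ℝ≥0∞}
    (hφ : Measurable φ ∧ ∫⁻ z, φ z ∂μ < ∞) (hψ : Measurable ψ ∧ ∫⁻ z, ψ z ∂ν < ∞) :
    Measurable (fun x : α × β => φ x.1 * ψ x.2) ∧
      ∫⁻ x, φ x.1 * ψ x.2 ∂(μ.prod ν) < ∞ := by
  have hm := hφ.1
  have hm' := hψ.1
  refine ⟨by fun_prop, ?_⟩
  rw [lintegral_prod_mul hm.aemeasurable hm'.aemeasurable]
  exact ENNReal.mul_lt_top hφ.2 hψ.2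

/-- Markov's inequality for the `p`-th power of `∏ i, K Q / (a |g i| |f i|)`, where `Q` is the noise
envelope. The expectation factors over the independent Gaussians and is finite for `p < 2`. -/
lemma exists_law_deepFade_le (R T₁ : ℕ) {K p : ℝ} (hK : 0 < K) (hp0 : 0 ≤ p) (hp : p < 2) :
    ∃ c : ℝ≥0∞, c ≠ ∞ ∧ ∀ a : ℝ, 0 < a →
      law R T₁ R {ω | ∀ i, a * (‖ω.g i‖ * ‖ω.f i‖) ≤ K * ω.noiseEnvelope} ≤
        c * ENNReal.ofReal (a ^ (-(p * R))) := by
  set m : ℝ := p * R with hm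
  have hm0 : 0 ≤ m := by positivity
  set φ : ℂ → ℝ≥0∞ := fun z => ‖z‖ₑ ^ (-p) with hφ
  set ψ : ℂ → ℝ≥0∞ := fun z => ‖z‖ₑ ^ (-p) * (1 + ‖z‖ₑ) ^ m with hψ
  set χ : ℂ → ℝ≥0∞ := fun z => (1 + ‖z‖ₑ) ^ m with hχ
  have mφ : Measurable φ := by fun_prop
  have mψ : Measurable ψ := by fun_prop
  have mχ : Measurable χ := by fun_prop
  have iφ : ∫⁻ z, φ z ∂stdComplexGaussian < ∞ := by
    simpa using lintegral_enorm_rpow_mul_stdComplexGaussian_lt_top hp0 hp le_rfl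
  have iψ : ∫⁻ z, ψ z ∂stdComplexGaussian < ∞ :=
    lintegral_enorm_rpow_mul_stdComplexGaussian_lt_top hp0 hp hm0
  have iχ : ∫⁻ z, χ z ∂stdComplexGaussian < ∞ := by
    simpa using lintegral_enorm_rpow_mul_stdComplexGaussian_lt_top le_rfl two_pos hm0
  set F : Realization R T₁ R → ℝ≥0∞ := fun ω =>
    (∏ i, φ (ω.1 i)) * ((∏ i, ψ (ω.2.1 i)) * ((∏ i, χ (ω.2.2.1 i)) *
      ((∏ i, ∏ t, χ (ω.2.2.2.1 i t)) * ((∏ i, χ (ω.2.2.2.2.1 i)) * ∏ i, χ (ω.2.2.2.2.2 i)))))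
    with hF
  have mF : Measurable F := by fun_prop
  refine ⟨ENNReal.ofReal (K ^ m) * ∫⁻ ω, F ω ∂law R T₁ R, ?_, fun a ha => ?_⟩
  · have hφ' := measurable_and_lintegral_pi_lt_top (ι := Fin R) ⟨mφ, iφ⟩
    have hψ' := measurable_and_lintegral_pi_lt_top (ι := Fin R) ⟨mψ, iψ⟩
    have hχ' := measurable_and_lintegral_pi_lt_top (ι := Fin R) ⟨mχ, iχ⟩
    have hχχ := measurable_and_lintegral_pi_lt_top (ι := Fin R)
      (measurable_and_lintegral_pi_lt_top (ι := Fin T₁) ⟨mχ, iχ⟩)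
    exact (ENNReal.mul_lt_top ENNReal.ofReal_lt_top
      (measurable_and_lintegral_prod_lt_top hφ' (measurable_and_lintegral_prod_lt_top hψ'
        (measurable_and_lintegral_prod_lt_top hχ' (measurable_and_lintegral_prod_lt_top hχχ
          (measurable_and_lintegral_prod_lt_top hχ' hχ'))))).2).ne
  · set A : ℝ≥0∞ := ENNReal.ofReal (K ^ m) * ENNReal.ofReal (a ^ (-m)) with hA
    have hsub : {ω : Realization R T₁ R | ∀ i, a * (‖ω.g i‖ * ‖ω.f i‖) ≤ K * ω.noiseEnvelope} ⊆
        {ω | 1 ≤ A * F ω} := by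
      intro ω hω
      have hQ : 0 < ω.noiseEnvelope :=
        lt_of_lt_of_le (zero_lt_one.trans_le (one_le_envelope _)) ω.le_noiseEnvelope.2.2.1
      set q : ℝ≥0∞ := ENNReal.ofReal (K / a * ω.noiseEnvelope) with hq
      have hone : ∀ i, 1 ≤ q ^ p * (φ (ω.g i) * φ (ω.f i)) := by
        intro i
        refine one_le_rpow_mul_of_mul_le enorm_ne_top enorm_ne_top ?_ ENNReal.ofReal_ne_top hp0 ?_
        · exact (ENNReal.ofReal_pos.2 (by positivity)).ne'
        · rw [← ofReal_norm, ← ofReal_norm, ← ENNReal.ofReal_mul (norm_nonneg _)]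
          refine ENNReal.ofReal_le_ofReal ?_
          rw [div_mul_eq_mul_div, le_div_iff₀ ha, mul_comm]
          exact hω i
      have hprod : 1 ≤ ∏ i, q ^ p * (φ (ω.g i) * φ (ω.f i)) := Finset.one_le_prod' fun i _ => hone i
      refine hprod.trans_eq ?_
      have hqm : ∏ _i : Fin R, q ^ p = q ^ m := by
        rw [Finset.prod_const, Finset.card_univ, Fintype.card_fin, ← ENNReal.rpow_natCast,
          ← ENNReal.rpow_mul]
      have hqA : q ^ m = A * ENNReal.ofReal ω.noiseEnvelope ^ m := by
        rw [hq, ENNReal.ofReal_mul (by positivity), ENNReal.mul_rpow_of_nonneg _ _ hm0,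
          ENNReal.ofReal_rpow_of_nonneg (by positivity) hm0, hA,
          ← ENNReal.ofReal_mul (by positivity), Real.div_rpow hK.le ha.le, Real.rpow_neg ha.le,
          div_eq_mul_inv]
      have henv : ∀ {ι : Type} [Fintype ι] (x : ι → ℂ),
          ENNReal.ofReal (envelope x) ^ m = ∏ i, χ (x i) := by
        intro ι _ x
        rw [ofReal_envelope, ← ENNReal.prod_rpow_of_nonneg hm0]
      have hQm : ENNReal.ofReal ω.noiseEnvelope ^ m = (∏ i, χ (ω.g i)) * ((∏ i, χ (ω.n i)) *
          ((∏ i, ∏ t, χ (ω.v i t)) * ((∏ i, χ (ω.u₁ i)) * ∏ i, χ (ω.u₂ i)))) := by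
        have h0 : ∀ {ι : Type} [Fintype ι] (x : ι → ℂ), 0 ≤ envelope x :=
          fun x => zero_le_one.trans (one_le_envelope x)
        rw [Realization.noiseEnvelope, ENNReal.ofReal_mul (h0 _), ENNReal.ofReal_mul (h0 _),
          ENNReal.ofReal_mul (Finset.prod_nonneg fun i _ => h0 _), ENNReal.ofReal_mul (h0 _),
          ENNReal.ofReal_prod_of_nonneg fun i _ => h0 _]
        simp only [ENNReal.mul_rpow_of_nonneg _ _ hm0, henv,
          ← ENNReal.prod_rpow_of_nonneg hm0]
      rw [Finset.prod_mul_distrib, Finset.prod_mul_distrib, hqm, hqA, hQm]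
      simp only [hF, hψ, Finset.prod_mul_distrib]
      simp only [Realization.f, Realization.g, Realization.n, Realization.v, Realization.u₁,
        Realization.u₂, hφ, hχ]
      ring
    calc law R T₁ R _ ≤ law R T₁ R {ω | 1 ≤ A * F ω} := measure_mono hsub
      _ ≤ ∫⁻ ω, A * F ω ∂law R T₁ R := by
          simpa using mul_meas_ge_le_lintegral (mF.const_mul A) (μ := law R T₁ R) 1
      _ = _ := by
          rw [lintegral_const_mul _ mF, hA]
          ring

namespace Scheme

variable {R T₁ L : ℕ} (X : Scheme R T₁ R L)

/-! ### The two bounds on the error probability -/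

lemma tendsto_relayGain (R : ℕ) :
    Tendsto (fun P : ℝ => relayGain 1 (1 / (R : ℝ)) P) atTop (𝓝 ((√(1 / (R : ℝ)) : ℝ) : ℂ)) := by
  have h : Tendsto (fun P : ℝ => 1 / (R : ℝ) * P / (1 * P + 1)) atTop (𝓝 (1 / (R : ℝ))) := by
    have h0 : Tendsto (fun P : ℝ => 1 / (R : ℝ) * (1 - 1 / (P + 1))) atTop
        (𝓝 (1 / (R : ℝ) * (1 - 0))) :=
      ((tendsto_const_nhds.div_atTop (tendsto_atTop_add_const_right _ _ tendsto_id)).const_sub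
        1).const_mul _
    rw [sub_zero, mul_one] at h0
    refine h0.congr' ?_
    filter_upwards [eventually_gt_atTop 0] with P hP
    have : P + 1 ≠ 0 := by linarith
    rw [one_mul, mul_div_assoc]
    congr 1
    field_simp
    ring
  exact (Complex.continuous_ofReal.tendsto _).comp ((Real.continuous_sqrt.tendsto _).comp h)

lemma eventually_errorProb_le (hR : 1 ≤ R) (hL : 1 ≤ L)
    (hC : ∀ l, (X.C l)ᴴ * X.C l = 1 ∧ X.C l * (X.C l)ᴴ = 1)
    (hrank : ∀ k l, k ≠ l → (X.C k - X.C l).rank = R)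
    {dec : (Fin R ⊕ Fin R → ℂ) → Fin L} (hdec : X.IsMismatchedDecoder dec) {t : ℝ} (ht0 : 0 ≤ t)
    (ht : t < R) :
    ∃ K : ℝ, ∀ᶠ P in atTop, X.errorProb dec 1 (1 / (R : ℝ)) P ≤ K * P ^ (-t) := by
  have hR0 : (0 : ℝ) < R := by exact_mod_cast hR
  have hL0 : (0 : ℝ) < L := by exact_mod_cast hL
  set β₀ : ℝ := √(1 / (R : ℝ)) with hβ₀
  have hβ₀pos : 0 < β₀ := by positivity
  have hβ₀le : β₀ ≤ 1 := by
    rw [hβ₀, Real.sqrt_le_one, div_le_one hR0]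
    exact_mod_cast hR
  have hgain : Tendsto (fun P : ℝ => ‖relayGain 1 (1 / (R : ℝ)) P‖) atTop (𝓝 β₀) := by
    have := (tendsto_relayGain R).norm
    rwa [Complex.norm_real, Real.norm_of_nonneg hβ₀pos.le] at this
  have hK : ∀ q : Fin L × Fin L, ∃ K : ℝ, q.1 ≠ q.2 →
      ∀ (a : ℝ) (b : ℂ) (ω : Realization R T₁ R), 0 ≤ a → β₀ / 2 ≤ ‖b‖ → ‖b‖ ≤ 2 →
      X.metric q.2 (X.output b q.2 (scaleFading a ω)) ≤
        X.metric q.1 (X.output b q.2 (scaleFading a ω)) →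
      ∀ i, a * (‖ω.g i‖ * ‖ω.f i‖) ≤ K * ω.noiseEnvelope := by
    intro q
    by_cases hq : q.1 = q.2
    · exact ⟨0, fun h => absurd hq h⟩
    · obtain ⟨K, hK⟩ := X.exists_fading_le_of_metric_le hC (hrank _ _ hq) (half_pos hβ₀pos)
      exact ⟨K, fun _ => hK⟩
  -- One constant for all pairs of messages, made positive by the maximum with `1`.
  choose K hK using hK
  obtain ⟨M, hM⟩ := (Set.finite_range K).bddAbove
  have hKM : ∀ q, K q ≤ max M 1 := fun q => (hM ⟨q, rfl⟩).trans (le_max_left _ _)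
  have hpR : 2 * t / R < 2 := by rw [div_lt_iff₀ hR0]; linarith
  obtain ⟨c, hc, hfade⟩ := exists_law_deepFade_le R T₁ (K := max M 1) (p := 2 * t / R)
    (lt_max_of_lt_right one_pos) (by positivity) hpR
  refine ⟨c.toReal, ?_⟩
  filter_upwards [hgain.eventually_const_lt (half_lt_self hβ₀pos),
    hgain.eventually_lt_const (show β₀ < 2 by linarith), eventually_gt_atTop 0] with P h1 h2 hP
  have hpow : √(1 * P) ^ (-(2 * t / R * R)) = P ^ (-t) := by
    rw [div_mul_cancel₀ _ hR0.ne', one_mul, Real.sqrt_eq_rpow, ← Real.rpow_mul hP.le]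
    congr 1; ring
  have hmsg : ∀ l, (law R T₁ R).real {ω | dec (X.received 1 (1 / (R : ℝ)) P l ω) ≠ l} ≤
      c.toReal * P ^ (-t) := by
    intro l
    have hsub : {ω | dec (X.received 1 (1 / (R : ℝ)) P l ω) ≠ l} ⊆
        {ω : Realization R T₁ R |
          ∀ i, √(1 * P) * (‖ω.g i‖ * ‖ω.f i‖) ≤ max M 1 * ω.noiseEnvelope} := by
      intro ω (hω : dec _ ≠ l) i
      have hmet := hdec (X.received 1 (1 / (R : ℝ)) P l ω) l
      generalize dec (X.received 1 (1 / (R : ℝ)) P l ω) = k at hω hmet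
      rw [received_eq_output] at hmet
      exact (hK (k, l) hω _ _ ω (Real.sqrt_nonneg _) h1.le h2.le hmet i).trans
        (mul_le_mul_of_nonneg_right (hKM _) ω.noiseEnvelope_nonneg)
    have hle := (measure_mono hsub).trans (hfade √(1 * P) (by positivity))
    rw [hpow] at hle
    refine (ENNReal.toReal_mono (ENNReal.mul_ne_top hc ENNReal.ofReal_ne_top) hle).trans_eq ?_
    rw [ENNReal.toReal_mul, ENNReal.toReal_ofReal (by positivity)]
  rw [errorProb, div_le_iff₀ hL0]
  calc _ ≤ ∑ _l : Fin L, c.toReal * P ^ (-t) := Finset.sum_le_sum fun l _ => hmsg l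
    _ = _ := by simp [mul_comm]

/-- If all relay paths carry nothing and the destination noise equals `(e, C_k e)`, then the
decoder strictly prefers `k` to `l`. This persists on an open set, and the probability of the
rescaled gains falling into it is of the order of `P ^ (-R)`. -/
lemma eventually_le_errorProb (hR : 1 ≤ R) (hL : 2 ≤ L)
    (hC : ∀ l, (X.C l)ᴴ * X.C l = 1 ∧ X.C l * (X.C l)ᴴ = 1)
    (hrank : ∀ k l, k ≠ l → (X.C k - X.C l).rank = R)
    {dec : (Fin R ⊕ Fin R → ℂ) → Fin L} (hdec : X.IsMismatchedDecoder dec) :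
    ∃ c : ℝ, 0 < c ∧ ∀ᶠ P in atTop,
      c * P ^ (-(R : ℝ)) ≤ X.errorProb dec 1 (1 / (R : ℝ)) P := by
  -- Errors of a single message `l` already give the right order.
  set l : Fin L := ⟨0, by lia⟩ with hl
  set k : Fin L := ⟨1, by lia⟩ with hk
  have hkl : k ≠ l := by simp [hl, hk]
  set β₀ : ℂ := ((√(1 / (R : ℝ)) : ℝ) : ℂ)
  set e : Fin R → ℂ := fun _ => 1 with he
  set x₀ : (Fin R → ℂ) × (Fin R → ℂ) × (Fin R → Fin T₁ → ℂ) × (Fin R → ℂ) × (Fin R → ℂ) :=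
    (0, 0, 0, e, X.C k *ᵥ e) with hx₀
  have hout : X.output β₀ l (0, x₀) = Sum.elim e (X.C k *ᵥ e) := by
    have h1 : X.signal β₀ ((0, x₀) : Realization R T₁ R) = 0 := by
      funext i; simp [signal, Realization.g, hx₀]
    have h2 : X.pilotNoise β₀ ((0, x₀) : Realization R T₁ R) = e := by
      funext i; simp [pilotNoise, Realization.g, Realization.u₁, hx₀]
    have h3 : X.dataNoise β₀ ((0, x₀) : Realization R T₁ R) = X.C k *ᵥ e := by
      funext a; simp [dataNoise, Realization.g, Realization.u₂, hx₀]
    rw [output, h1, h2, h3, Matrix.mulVec_zero, zero_add, zero_add]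
  have hbad : X.metric l (X.output β₀ l (0, x₀)) < X.metric k (X.output β₀ l (0, x₀)) := by
    rw [hout, X.metric_eq_sub_residual (hC l), X.metric_eq_sub_residual (hC k)]
    simp only [Sum.elim_comp_inl, Sum.elim_comp_inr, sub_self]
    have hne : euclNorm (X.C k *ᵥ e - X.C l *ᵥ e) ≠ 0 := by
      rw [← Matrix.sub_mulVec, Ne, euclNorm_eq_zero]
      obtain ⟨D, -, hD⟩ := exists_norm_apply_le_euclNorm_mulVec
        ((hrank k l hkl).trans (Fintype.card_fin R).symm)
      intro h0
      have := hD e ⟨0, hR⟩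
      rw [h0, euclNorm_eq_zero.2 rfl, mul_zero, he] at this
      norm_num at this
    have hz : euclNorm (0 : Fin R → ℂ) = 0 := euclNorm_eq_zero.2 rfl
    have := sq_pos_of_ne_zero hne
    rw [hz]
    linarith
  have hcont := X.continuous_output l
  have hnhds : ∀ᶠ q : ℂ × Realization R T₁ R in 𝓝 (β₀, (0, x₀)),
      X.metric l (X.output q.1 l q.2) < X.metric k (X.output q.1 l q.2) :=
    ((X.continuous_metric l).comp hcont).continuousAt.eventually_lt
      ((X.continuous_metric k).comp hcont).continuousAt hbad
  rw [nhds_prod_eq] at hnhds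
  obtain ⟨pb, hpb, pω, hpω, hboth⟩ := eventually_prod_iff.1 hnhds
  obtain ⟨ε, hε, hball⟩ := Metric.eventually_nhds_iff_ball.1 hpω
  obtain ⟨c, hc, hdisc⟩ := exists_le_stdComplexGaussian_ball
  set ν : Measure ((Fin R → ℂ) × (Fin R → ℂ) × (Fin R → Fin T₁ → ℂ) × (Fin R → ℂ) ×
    (Fin R → ℂ)) := (Measure.pi fun _ => stdComplexGaussian).prod
      ((Measure.pi fun _ => stdComplexGaussian).prod
        ((Measure.pi fun _ => Measure.pi fun _ => stdComplexGaussian).prod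
          ((Measure.pi fun _ => stdComplexGaussian).prod
            (Measure.pi fun _ => stdComplexGaussian)))) with hν
  have : ν.IsOpenPosMeasure := by
    rw [hν]
    set_option synthInstance.maxSize 1000 in infer_instance
  have hlaw : law R T₁ R = (Measure.pi fun _ => stdComplexGaussian).prod ν := rfl
  have hνpos : 0 < ν.real (Metric.ball x₀ ε) :=
    ENNReal.toReal_pos (Metric.measure_ball_pos ν x₀ hε).ne' (measure_ne_top _ _)
  have hL0 : (0 : ℝ) < L := by exact_mod_cast (by lia : 0 < L)
  refine ⟨(c * ε ^ 2) ^ R * ν.real (Metric.ball x₀ ε) / L, by positivity, ?_⟩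
  -- `P > ε ^ 2` keeps the radius `ε / √P` of the discs below `1`.
  filter_upwards [(tendsto_relayGain R).eventually hpb, eventually_gt_atTop (max 0 (ε ^ 2))] with
    P hgain hPgt
  obtain ⟨hP, hPε⟩ := max_lt_iff.1 hPgt
  have hsP : 0 < √P := Real.sqrt_pos.2 hP
  set A : Set (Fin R → ℂ) := Set.univ.pi fun _ => Metric.ball 0 (ε / √P) with hA
  have hsub : A ×ˢ Metric.ball x₀ ε ⊆
      {ω : Realization R T₁ R | dec (X.received 1 (1 / (R : ℝ)) P l ω) ≠ l} := by
    rintro ⟨f, x⟩ ⟨hf, hx⟩ hdl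
    have hmem : scaleFading √(1 * P) (f, x) ∈ Metric.ball ((0, x₀) : Realization R T₁ R) ε := by
      rw [← ball_prod_same]
      refine ⟨?_, hx⟩
      rw [mem_ball_zero_iff, pi_norm_lt_iff hε]
      intro i
      have hfi := hf i (Set.mem_univ i)
      rw [mem_ball_zero_iff, lt_div_iff₀ hsP] at hfi
      simp only [scaleFading, Realization.f, one_mul, norm_mul, Complex.norm_real,
        Real.norm_of_nonneg hsP.le]
      rwa [mul_comm]
    have h1 := hboth hgain (hball _ hmem)
    have h2 := hdec (X.received 1 (1 / (R : ℝ)) P l (f, x)) k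
    rw [hdl, received_eq_output] at h2
    exact absurd h2 (not_le.2 h1)
  have hAle : (c * ε ^ 2 / P) ^ R ≤ (Measure.pi fun _ : Fin R => stdComplexGaussian).real A := by
    have h1 : ENNReal.ofReal (c * ε ^ 2 / P) ≤ stdComplexGaussian (Metric.ball 0 (ε / √P)) := by
      refine le_of_eq_of_le ?_ (hdisc (ε / √P) (by positivity) ?_)
      · rw [div_pow, Real.sq_sqrt hP.le, mul_div_assoc]
      · rw [div_le_one hsP]
        exact Real.le_sqrt_of_sq_le hPε.le
    rw [measureReal_def, hA, Measure.pi_pi, ENNReal.toReal_prod, Finset.prod_const,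
      Finset.card_univ, Fintype.card_fin]
    exact pow_le_pow_left₀ (by positivity)
      ((ENNReal.ofReal_le_iff_le_toReal (measure_ne_top _ _)).1 h1) R
  have hmsg : (c * ε ^ 2 / P) ^ R * ν.real (Metric.ball x₀ ε) ≤
      (law R T₁ R).real {ω | dec (X.received 1 (1 / (R : ℝ)) P l ω) ≠ l} := by
    refine le_trans ?_ (measureReal_mono hsub)
    rw [hlaw, measureReal_prod_prod]
    gcongr
  rw [errorProb]
  calc _ = (c * ε ^ 2 / P) ^ R * ν.real (Metric.ball x₀ ε) / L := by
        rw [Real.rpow_neg hP.le, Real.rpow_natCast, div_pow]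
        field_simp
    _ ≤ _ := by
        gcongr
        refine hmsg.trans ?_
        exact Finset.single_le_sum (f := fun l => (law R T₁ R).real
          {ω | dec (X.received 1 (1 / (R : ℝ)) P l ω) ≠ l}) (fun _ _ => measureReal_nonneg)
          (Finset.mem_univ l)

end Scheme

end RelayNet

theorem theorem1 (R T₁ L : ℕ) (hR : 1 ≤ R) (hL : 2 ≤ L)
    (X : RelayNet.Scheme R T₁ R L)
    (hB : ∀ i, (X.B i * (X.B i)ᴴ).IsDiag)
    (hC : ∀ l, (X.C l)ᴴ * X.C l = 1 ∧ X.C l * (X.C l)ᴴ = 1)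
    (hrank : ∀ k l, k ≠ l → (X.C k - X.C l).rank = R)
    (dec : (Fin R ⊕ Fin R → ℂ) → Fin L) (hdec : X.IsMismatchedDecoder dec) :
    RelayNet.HasDiversityOrder (fun P => X.errorProb dec 1 (1 / (R : ℝ)) P) (R : ℝ) :=
  RelayNet.hasDiversityOrder_of_bounds (by exact_mod_cast hR)
    (fun _ ht0 ht => X.eventually_errorProb_le hR (by lia) hC hrank hdec ht0.le ht)
    (X.eventually_le_errorProb hR hL hC hrank hdec)
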